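/- Let $r_1,r_2$ be complex-valued functions on $\mathbb{R}\cup i\mathbb{R}$ for which there is a constant $c_0<1$ with $|r_j(k)|\le c_0$ for all $k\in\mathbb{R}\cup i\mathbb{R}$, $j=1,2$. Put $z=k^2$. For each $z\in\mathbb{R}$ fix a square root $k=k(z)\in\mathbb{R}\cup i\mathbb{R}$ of $z$ (any choice is allowed), and use it to regard functions of $k$ as functions of $z\in\mathbb{R}$; $L^2_z$ denotes $L^2(\mathbb{R},dz)$, applied entrywise to matrix-valued functions. Put $$r_-(z)=2ik\,r_1(k),\qquad r_+(z)=-\frac{r_2(k)}{2ik},$$ and assume $r_1(k),r_2(k)\in L^2_z$ and $r_\pm\in L^2_z$. For $x\in\mathbb{R}$ let $$S(x,k)=\begin{bmatrix}-r_1(k)r_2(k)&-r_2(k)e^{-2ik^2x}\\ r_1(k)e^{2ik^2x}&0\end{bmatrix},\quad \rho_1(k)=\begin{bmatrix}1&0\\0&2ik\end{bmatrix},\quad \rho_2(k)=\begin{bmatrix}\frac1{2ik}&0\\0&1\end{bmatrix},\quad F_j(x,k)=\rho_j(k)S(x,k).$$ Let $\mathcal{C}^-(f)(z)=\lim_{\varepsilon\downarrow0}\frac1{2\pi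 i}\int_{\mathbb{R}}\frac{f(s)}{s-(z-i\varepsilon)}\,ds$ (for a.e. $z\in\mathbb{R}$, entrywise for matrix-valued $f$), and $\mathcal{C}^-_SN=\mathcal{C}^-(NS)$. Then for every $x\in\mathbb{R}$ and $j=1,2$ the equation $$(I-\mathcal{C}^-_S)N=\mathcal{C}^-(F_j)$$ has a unique $2\times2$ matrix-valued solution $N\in L^2_z$. Moreover, for every $x\in\mathbb{R}$, on the space of $m\times2$ matrix-valued functions in $L^2_z$ (for every $m$; in particular row vectors, $m=1$, and $2\times 2$ matrices, $m=2$), $\mathcal{C}^-_S$ is a bounded operator and $I-\mathcal{C}^-_S$ is invertible with bounded inverse $(I-\mathcal{C}^-_S)^{-1}$. -/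

import Mathlib

open MeasureTheory Filter Topology

noncomputable section

namespace NDNLS

/-- The contour `ℝ ∪ iℝ` in the `k`-plane; it is the preimage of `ℝ` under `k ↦ z = k ^ 2`. -/
def contour : Set ℂ := {k : ℂ | k.im = 0 ∨ k.re = 0}

/-- The jump matrix `S(x, k)`. -/
def jumpS (r₁ r₂ : ℂ → ℂ) (x : ℝ) (k : ℂ) : Matrix (Fin 2) (Fin 2) ℂ :=
  !![-(r₁ k * r₂ k), -(r₂ k * Complex.exp (-2 * Complex.I * k ^ 2 * x));
     r₁ k * Complex.exp (2 * Complex.I * k ^ 2 * x), 0]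

/-- The matrices `ρ₁(k) = diag(1, 2ik)` (index `0`) and `ρ₂(k) = diag(1/(2ik), 1)` (index `1`). -/
def rho (j : Fin 2) (k : ℂ) : Matrix (Fin 2) (Fin 2) ℂ :=
  if j = 0 then !![1, 0; 0, 2 * Complex.I * k] else !![1 / (2 * Complex.I * k), 0; 0, 1]

/-- The inhomogeneity `F_j(x, k) = ρ_j(k) S(x, k)`. -/
def inhomF (r₁ r₂ : ℂ → ℂ) (j : Fin 2) (x : ℝ) (k : ℂ) : Matrix (Fin 2) (Fin 2) ℂ :=
  rho j k * jumpS r₁ r₂ x k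

/-- `r₋(z) = 2 i k r₁(k)`, where `k = κ z` is the square root of `z`. For odd `r₁` this does not
depend on which of the two square roots is used. -/
def rMinus (κ : ℝ → ℂ) (r₁ : ℂ → ℂ) (z : ℝ) : ℂ := 2 * Complex.I * κ z * r₁ (κ z)

/-- `r₊(z) = - r₂(k) / (2 i k)`, where `k = κ z` is the square root of `z`. For odd `r₂` this does
not depend on which of the two square roots is used. -/
def rPlus (κ : ℝ → ℂ) (r₂ : ℂ → ℂ) (z : ℝ) : ℂ := -(r₂ (κ z) / (2 * Complex.I * κ z))

/-- The Cauchy operator `C(f)(w) = (2πi)⁻¹ ∫ f(s) / (s - w) ds`, for `w` off the real line. -/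
def cauchyIntegral (f : ℝ → ℂ) (w : ℂ) : ℂ :=
  1 / (2 * Real.pi * Complex.I) * ∫ s : ℝ, f s / ((s : ℂ) - w)

/-- `g = C⁻(f)` for matrix-valued functions on the line: for almost every `z`, the limit of
`C(f)(z - iε)` as `ε ↓ 0` exists entry by entry and equals `g z`. -/
def IsCauchyMinus {m : ℕ} (f g : ℝ → Matrix (Fin m) (Fin 2) ℂ) : Prop :=
  ∀ᵐ z : ℝ, ∀ (i : Fin m) (l : Fin 2),
    Tendsto (fun ε : ℝ => cauchyIntegral (fun s => f s i l) ((z : ℂ) - ε * Complex.I))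
      (𝓝[>] 0) (𝓝 (g z i l))

/-- The space `L²_z(ℝ)` of `m × 2` matrix-valued functions (`m = 1`: row vectors), given by their
entries in `L²(ℝ, ℂ)`; the norm is `(∑ ‖N_{il}‖²)^{1/2}`, that is `(∫ tr (N Nᴴ) dz)^{1/2}`. -/
abbrev L2Mat (m : ℕ) : Type := PiLp 2 (fun _ : Fin m × Fin 2 => Lp ℂ 2 (volume : Measure ℝ))

/-- The matrix-valued function represented by an element of `L2Mat m`. -/
def L2Mat.eval {m : ℕ} (N : L2Mat m) (z : ℝ) : Matrix (Fin m) (Fin 2) ℂ :=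
  Matrix.of fun i l => N (i, l) z

/-- `N` solves `(I - C⁻_S) N = C⁻(F)` almost everywhere, where `C⁻_S N = C⁻(N S)`. -/
def SolvesEquation {m : ℕ} (S : ℝ → Matrix (Fin 2) (Fin 2) ℂ)
    (F : ℝ → Matrix (Fin m) (Fin 2) ℂ) (N : L2Mat m) : Prop :=
  ∃ A B : ℝ → Matrix (Fin m) (Fin 2) ℂ,
    IsCauchyMinus (fun z => N.eval z * S z) A ∧ IsCauchyMinus F B ∧
      ∀ᵐ z : ℝ, N.eval z - A z = B z

end NDNLS

end

open scoped InnerProductSpace ComplexConjugate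

/-! On `L²(ℝ)` the operator `C⁻` is minus the orthogonal projection onto the Hardy space of the
lower half-plane, so `C⁻` and `1 + C⁻` both have norm at most one. With `a = r₁ e^{2izx}` and `b =
r₂ e^{-2izx}`, both bounded by `c₀`, a row `(n₁, n₂)` of `N - C⁻(N S) = (g₁, g₂)` reads `n₁ + C⁻(a b
n₁) - C⁻(a n₂) = g₁` and `n₂ + C⁻(b n₁) = g₂`. Eliminating `n₂` leaves `n₁ + C⁻ a (1 + C⁻) b n₁ = g₁
+ C⁻ a g₂`, a perturbation of the identity of norm at most `c₀² < 1`, which a Neumann series inverts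
(`exists_schur_inverse`, `exists_inverse_one_sub_cauchyJump`).

The pointwise definition of `C⁻` must be matched with this projection. Below the axis, `f` and its
projection have the same Cauchy integral; that of the projection vanishes above the axis.
Subtracting the values at `z ± iε` turns it into a Poisson integral (`cauchyIntegral_eq_poisson`),
which converges almost everywhere by Lebesgue differentiation (`ae_tendsto_integral_poissonKernel`).
-/

namespace NDNLS

/-! ### Almost everywhere convergence of Poisson integrals -/

section Poisson

/-- The density `q` with `∫_{r > a} q(r) dr = ε / (a² + ε²)`. -/
noncomputable def poissonDensity (ε r : ℝ) : ℝ := 2 * r * ε / (r ^ 2 + ε ^ 2) ^ 2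

lemma hasDerivAt_poissonKernel {ε : ℝ} (hε : 0 < ε) (r : ℝ) :
    HasDerivAt (fun r : ℝ => -(ε / (r ^ 2 + ε ^ 2))) (poissonDensity ε r) r := by
  have h : r ^ 2 + ε ^ 2 ≠ 0 := by positivity
  have h1 : HasDerivAt (fun r : ℝ => r ^ 2 + ε ^ 2) (2 * r) r := by
    simpa using (hasDerivAt_pow 2 r).add_const (ε ^ 2)
  refine (((hasDerivAt_const r ε).div h1 h).neg).congr_deriv ?_
  unfold poissonDensity
  field_simp
  ring

lemma tendsto_poissonKernel_atTop (ε : ℝ) :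
    Tendsto (fun r : ℝ => -(ε / (r ^ 2 + ε ^ 2))) atTop (𝓝 0) := by
  have h : Tendsto (fun r : ℝ => r ^ 2 + ε ^ 2) atTop atTop :=
    tendsto_atTop_add_const_right _ _ (tendsto_pow_atTop two_ne_zero)
  simpa using (h.const_div_atTop ε).neg

lemma poissonDensity_nonneg {ε r : ℝ} (hε : 0 < ε) (hr : 0 ≤ r) : 0 ≤ poissonDensity ε r := by
  unfold poissonDensity
  positivity

lemma integrableOn_poissonDensity {ε a : ℝ} (hε : 0 < ε) (ha : 0 ≤ a) :
    IntegrableOn (poissonDensity ε) (Set.Ioi a) :=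
  integrableOn_Ioi_deriv_of_nonneg' (fun r _ => hasDerivAt_poissonKernel hε r)
    (fun _ hr => poissonDensity_nonneg hε (ha.trans (le_of_lt hr)))
    (tendsto_poissonKernel_atTop ε)

lemma integral_poissonDensity {ε a : ℝ} (hε : 0 < ε) (ha : 0 ≤ a) :
    ∫ r in Set.Ioi a, poissonDensity ε r = ε / (a ^ 2 + ε ^ 2) := by
  rw [integral_Ioi_of_hasDerivAt_of_tendsto' (fun r _ => hasDerivAt_poissonKernel hε r)
    (integrableOn_poissonDensity hε ha) (tendsto_poissonKernel_atTop ε)]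
  ring

lemma measurable_poissonDensity (ε : ℝ) : Measurable (poissonDensity ε) := by
  unfold poissonDensity
  fun_prop

lemma integrable_inv_sub_sq_add_sq (z : ℝ) {ε : ℝ} (hε : ε ≠ 0) :
    Integrable (fun s : ℝ => ((s - z) ^ 2 + ε ^ 2)⁻¹) := by
  have h := ((integrable_inv_one_add_sq.comp_div hε).comp_sub_right z).const_mul ((ε ^ 2)⁻¹)
  refine h.congr (ae_of_all _ fun s => ?_)
  simp only
  rw [← mul_inv]
  congr 1
  field_simp
  ring

lemma memLp_poissonKernel (z : ℝ) {ε : ℝ} (hε : 0 < ε) :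
    MemLp (fun s : ℝ => ε / ((s - z) ^ 2 + ε ^ 2)) 2 := by
  have hm : Measurable (fun s : ℝ => ε / ((s - z) ^ 2 + ε ^ 2)) := by fun_prop
  rw [memLp_two_iff_integrable_sq hm.aestronglyMeasurable]
  refine (integrable_inv_sub_sq_add_sq z hε.ne').mono (hm.pow_const 2).aestronglyMeasurable
    (ae_of_all _ fun s => ?_)
  rw [Real.norm_of_nonneg (by positivity), Real.norm_of_nonneg (by positivity), div_pow,
    div_le_iff₀ (by positivity)]
  have : (0 : ℝ) < (s - z) ^ 2 + ε ^ 2 := by positivity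
  field_simp
  nlinarith [sq_nonneg (s - z)]

lemma setIntegral_indicator_Ici {q : ℝ → ℝ} {a : ℝ} (ha : 0 ≤ a) :
    ∫ r in Set.Ioi (0 : ℝ), (Set.Ici a).indicator q r = ∫ r in Set.Ioi a, q r := by
  rw [setIntegral_indicator measurableSet_Ici, ← integral_Ici_eq_integral_Ioi]
  refine setIntegral_congr_set ?_
  have h : (Set.Ioi (0 : ℝ) : Set ℝ) =ᵐ[volume] (Set.Ici 0 : Set ℝ) := Ioi_ae_eq_Ici
  refine (h.inter (ae_eq_refl _)).trans (Eventually.of_forall fun x => ?_)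
  have : Set.Ici (0 : ℝ) ∩ Set.Ici a = Set.Ici a :=
    Set.inter_eq_right.2 (Set.Ici_subset_Ici.2 ha)
  rw [this]

/-- Integrating out `r` first gives the Poisson kernel times `‖f‖`, a product of two `L²` functions.
This licenses Fubini in the layer decomposition. -/
lemma integrable_layers {f : ℝ → ℂ} (hf : MemLp f 2) (z : ℝ) {ε : ℝ} (hε : 0 < ε) :
    Integrable (Function.uncurry fun s r : ℝ =>
      (Set.Ici |s - z|).indicator (poissonDensity ε) r • f s)
      (volume.prod (volume.restrict (Set.Ioi 0))) := by
  have hmeas : Measurable (fun p : ℝ × ℝ => (Set.Ici |p.1 - z|).indicator (poissonDensity ε) p.2) := by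
    have : (fun p : ℝ × ℝ => (Set.Ici |p.1 - z|).indicator (poissonDensity ε) p.2) =
        {p : ℝ × ℝ | |p.1 - z| ≤ p.2}.indicator (fun p => poissonDensity ε p.2) := by
      ext p
      simp [Set.indicator]
    rw [this]
    exact ((measurable_poissonDensity ε).comp measurable_snd).indicator
      (measurableSet_le (by fun_prop) measurable_snd)
  have hint (s : ℝ) : Integrable (fun r => (Set.Ici |s - z|).indicator (poissonDensity ε) r)
      (volume.restrict (Set.Ioi 0)) :=
    (integrableOn_poissonDensity hε le_rfl).integrable.indicator measurableSet_Ici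
  have hnorm (s : ℝ) : ∫ r in Set.Ioi (0 : ℝ),
      ‖(Set.Ici |s - z|).indicator (poissonDensity ε) r • f s‖
        = ε / ((s - z) ^ 2 + ε ^ 2) * ‖f s‖ := by
    have : ∀ r ∈ Set.Ioi (0 : ℝ), ‖(Set.Ici |s - z|).indicator (poissonDensity ε) r • f s‖
        = (Set.Ici |s - z|).indicator (poissonDensity ε) r * ‖f s‖ := by
      intro r hr
      rw [norm_smul, Real.norm_of_nonneg]
      exact Set.indicator_apply_nonneg fun _ => poissonDensity_nonneg hε (le_of_lt hr)
    rw [setIntegral_congr_fun measurableSet_Ioi this, integral_mul_const,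
      setIntegral_indicator_Ici (abs_nonneg _), integral_poissonDensity hε (abs_nonneg _), sq_abs]
  rw [integrable_prod_iff]
  · refine ⟨ae_of_all _ fun s => (hint s).smul_const (f s), ?_⟩
    simp only [Function.uncurry, hnorm]
    exact (memLp_poissonKernel z hε).integrable_mul hf.norm
  · exact hmeas.aestronglyMeasurable.smul hf.1.comp_fst

/-- The kernel decreases in `|s - z|`, so it is a superposition of indicators of balls. After the
scaling `r = ε t` the weight on the averages no longer depends on `ε`. -/
lemma integral_poissonKernel_eq {f : ℝ → ℂ} (hf : MemLp f 2) (z : ℝ) {ε : ℝ} (hε : 0 < ε) :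
    ∫ s, (ε / ((s - z) ^ 2 + ε ^ 2)) • f s =
      ∫ t in Set.Ioi (0 : ℝ), (4 * t ^ 2 / (1 + t ^ 2) ^ 2) •
        ⨍ s in Metric.closedBall z (ε * t), f s := by
  have h1 : ∫ s, (ε / ((s - z) ^ 2 + ε ^ 2)) • f s =
      ∫ s, ∫ r in Set.Ioi (0 : ℝ), (Set.Ici |s - z|).indicator (poissonDensity ε) r • f s := by
    refine integral_congr_ae (ae_of_all _ fun s => ?_)
    simp only
    rw [integral_smul_const, setIntegral_indicator_Ici (abs_nonneg _),
      integral_poissonDensity hε (abs_nonneg _), sq_abs]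
  have h2 (r : ℝ) : ∫ s, (Set.Ici |s - z|).indicator (poissonDensity ε) r • f s =
      poissonDensity ε r • ∫ s in Metric.closedBall z r, f s := by
    rw [← integral_smul, ← integral_indicator Metric.isClosed_closedBall.measurableSet]
    refine integral_congr_ae (ae_of_all _ fun s => ?_)
    by_cases h : |s - z| ≤ r <;> simp [Set.indicator, Real.dist_eq, h]
  rw [h1, integral_integral_swap (integrable_layers hf z hε)]
  simp only [h2]
  have h3 := integral_comp_mul_left_Ioi
    (fun r => poissonDensity ε r • ∫ s in Metric.closedBall z r, f s) 0 hε
  rw [mul_zero] at h3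
  rw [← smul_inv_smul₀ hε.ne' (∫ r in Set.Ioi (0 : ℝ), _), ← h3, ← integral_smul]
  refine setIntegral_congr_fun measurableSet_Ioi fun t ht => ?_
  have ht : 0 < t := ht
  rw [setAverage_eq, Measure.real, Real.volume_closedBall, ENNReal.toReal_ofReal (by positivity),
    smul_smul, smul_smul]
  congr 1
  unfold poissonDensity
  field_simp
  ring

lemma hasDerivAt_layerWeight (t : ℝ) :
    HasDerivAt (fun t : ℝ => 2 * (Real.arctan t - t / (1 + t ^ 2)))
      (4 * t ^ 2 / (1 + t ^ 2) ^ 2) t := by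
  have h : 1 + t ^ 2 ≠ 0 := by positivity
  have h1 : HasDerivAt (fun t : ℝ => 1 + t ^ 2) (2 * t) t := by
    simpa using (hasDerivAt_pow 2 t).const_add 1
  refine (((Real.hasDerivAt_arctan t).sub ((hasDerivAt_id t).div h1 h)).const_mul 2).congr_deriv ?_
  simp only [id]
  field_simp
  ring

lemma tendsto_layerWeight :
    Tendsto (fun t : ℝ => 2 * (Real.arctan t - t / (1 + t ^ 2))) atTop (𝓝 Real.pi) := by
  have h2 : Tendsto (fun t : ℝ => t / (1 + t ^ 2)) atTop (𝓝 0) := by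
    refine squeeze_zero' ((eventually_gt_atTop 0).mono fun t ht => by positivity)
      ((eventually_gt_atTop 0).mono fun t ht => ?_) tendsto_inv_atTop_zero
    rw [div_le_iff₀ (by positivity)]
    field_simp
    nlinarith
  have h1 : Tendsto Real.arctan atTop (𝓝 (Real.pi / 2)) :=
    Real.tendsto_arctan_atTop.mono_right nhdsWithin_le_nhds
  have := (h1.sub h2).const_mul 2
  rwa [sub_zero, mul_div_cancel₀ _ two_ne_zero] at this

lemma integrableOn_layerWeight :
    IntegrableOn (fun t : ℝ => 4 * t ^ 2 / (1 + t ^ 2) ^ 2) (Set.Ioi 0) :=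
  integrableOn_Ioi_deriv_of_nonneg' (fun t _ => hasDerivAt_layerWeight t)
    (fun _ _ => by positivity) tendsto_layerWeight

lemma integral_layerWeight :
    ∫ t in Set.Ioi (0 : ℝ), 4 * t ^ 2 / (1 + t ^ 2) ^ 2 = Real.pi := by
  rw [integral_Ioi_of_hasDerivAt_of_tendsto' (fun t _ => hasDerivAt_layerWeight t)
    integrableOn_layerWeight tendsto_layerWeight]
  simp

/-- Integrate `|f| ≤ 1 + |f|²` over the ball. -/
lemma norm_average_closedBall_le {f : ℝ → ℂ} (hf : MemLp f 2) (z : ℝ) {r : ℝ} (hr : 0 < r) :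
    ‖⨍ s in Metric.closedBall z r, f s‖ ≤ 1 + (∫ s, ‖f s‖ ^ 2) / (2 * r) := by
  have hsq : Integrable (fun s => ‖f s‖ ^ 2) :=
    (memLp_two_iff_integrable_sq_norm hf.1).1 hf
  rw [setAverage_eq, Measure.real, Real.volume_closedBall, ENNReal.toReal_ofReal (by positivity),
    norm_smul, Real.norm_of_nonneg (by positivity)]
  have hfin : volume (Metric.closedBall z r) ≠ ⊤ := measure_closedBall_lt_top.ne
  have hconst : IntegrableOn (fun _ : ℝ => (1 : ℝ)) (Metric.closedBall z r) := by
    exact integrableOn_const hfin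
  have h : ‖∫ s in Metric.closedBall z r, f s‖ ≤ 2 * r + ∫ s, ‖f s‖ ^ 2 := calc
    _ ≤ ∫ s in Metric.closedBall z r, ((1 : ℝ) + ‖f s‖ ^ 2) := by
        refine norm_integral_le_of_norm_le (hconst.add hsq.integrableOn) (ae_of_all _ fun s => ?_)
        nlinarith [sq_nonneg (‖f s‖ - 1), sq_nonneg ‖f s‖]
    _ = 2 * r + ∫ s in Metric.closedBall z r, ‖f s‖ ^ 2 := by
        rw [integral_add hconst hsq.integrableOn]
        simp [Measure.real, Real.volume_closedBall, hr.le]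
    _ ≤ _ := by
        exact add_le_add le_rfl
          (setIntegral_le_integral hsq (Eventually.of_forall fun s => sq_nonneg ‖f s‖))
  calc (2 * r)⁻¹ * ‖∫ s in Metric.closedBall z r, f s‖
      ≤ (2 * r)⁻¹ * (2 * r + ∫ s, ‖f s‖ ^ 2) := by gcongr
    _ = _ := by field_simp

/-- On the line a ball average is a difference of values of a continuous primitive, hence measurable
in the radius. -/
lemma exists_measurable_average_closedBall {f : ℝ → ℂ} (hf : LocallyIntegrable f) (z : ℝ) :
    ∃ g : ℝ → ℂ, Measurable g ∧ ∀ r, 0 < r → g r = ⨍ s in Metric.closedBall z r, f s := by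
  have hi (a b : ℝ) : IntervalIntegrable f volume a b :=
    (hf.integrableOn_isCompact isCompact_uIcc).intervalIntegrable
  have hc : Continuous fun b => ∫ s in (0 : ℝ)..b, f s := intervalIntegral.continuous_primitive hi 0
  have hm := hc.measurable
  refine ⟨fun r => (2 * r)⁻¹ • ((∫ s in (0 : ℝ)..(z + r), f s) - ∫ s in (0 : ℝ)..(z - r), f s),
    ?_, fun r hr => ?_⟩
  · exact Measurable.smul (by fun_prop : Measurable fun r : ℝ => (2 * r)⁻¹)
      ((hm.comp (by fun_prop : Measurable fun r : ℝ => z + r)).sub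
        (hm.comp (by fun_prop : Measurable fun r : ℝ => z - r)))
  · simp only
    rw [setAverage_eq, Measure.real, Real.volume_closedBall, ENNReal.toReal_ofReal (by positivity),
      intervalIntegral.integral_interval_sub_left (hi _ _) (hi _ _),
      intervalIntegral.integral_of_le (by linarith), Real.closedBall_eq_Icc,
      integral_Icc_eq_integral_Ioc]

/-- Poisson integrals of `L²` functions converge almost everywhere. -/
theorem ae_tendsto_integral_poissonKernel {f : ℝ → ℂ} (hf : MemLp f 2) :
    ∀ᵐ z : ℝ, Tendsto (fun ε : ℝ => ∫ s, (ε / ((s - z) ^ 2 + ε ^ 2)) • f s)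
      (𝓝[>] 0) (𝓝 (Real.pi • f z)) := by
  have hloc : LocallyIntegrable f := hf.locallyIntegrable (by norm_num)
  filter_upwards [IsUnifLocDoublingMeasure.ae_tendsto_average volume hloc 1] with z hz
  have havg : Tendsto (fun r => ⨍ s in Metric.closedBall z r, f s) (𝓝[>] 0) (𝓝 (f z)) := by
    refine hz (fun _ => z) id tendsto_id ?_
    filter_upwards [self_mem_nhdsWithin] with r hr
    simpa using (le_of_lt hr : (0 : ℝ) ≤ r)
  -- Small radii are controlled by convergence of the averages, large ones by the `L²` norm; `B`
  -- then serves for dominated convergence.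
  obtain ⟨B, hB⟩ : ∃ B : ℝ, ∀ r : ℝ, 0 < r → ‖⨍ s in Metric.closedBall z r, f s‖ ≤ B := by
    have h1 : ∀ᶠ r in 𝓝[>] (0 : ℝ), ‖⨍ s in Metric.closedBall z r, f s‖ < ‖f z‖ + 1 :=
      havg.norm.eventually_lt_const (lt_add_one _)
    obtain ⟨δ, hδ, h1⟩ := (mem_nhdsGT_iff_exists_Ioo_subset).1 h1
    have hδ : 0 < δ := hδ
    refine ⟨max (‖f z‖ + 1) (1 + (∫ s, ‖f s‖ ^ 2) / (2 * δ)), fun r hr => ?_⟩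
    rcases lt_or_ge r δ with h | h
    · exact (le_of_lt (h1 ⟨hr, h⟩)).trans (le_max_left _ _)
    · refine (norm_average_closedBall_le hf z hr).trans (le_trans ?_ (le_max_right _ _))
      have : 0 ≤ ∫ s, ‖f s‖ ^ 2 := integral_nonneg fun s => by positivity
      gcongr
  have key : Tendsto (fun ε : ℝ => ∫ t in Set.Ioi (0 : ℝ), (4 * t ^ 2 / (1 + t ^ 2) ^ 2) •
        ⨍ s in Metric.closedBall z (ε * t), f s) (𝓝[>] 0)
      (𝓝 (∫ t in Set.Ioi (0 : ℝ), (4 * t ^ 2 / (1 + t ^ 2) ^ 2) • f z)) := by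
    refine tendsto_integral_filter_of_dominated_convergence
      (fun t => 4 * t ^ 2 / (1 + t ^ 2) ^ 2 * B) ?_ ?_ (integrableOn_layerWeight.mul_const B) ?_
    · filter_upwards [self_mem_nhdsWithin] with ε hε
      have hε : 0 < ε := hε
      obtain ⟨g, hg, hgf⟩ := exists_measurable_average_closedBall hloc z
      refine ((show Measurable fun t : ℝ => (4 * t ^ 2 / (1 + t ^ 2) ^ 2) • g (ε * t) by
        fun_prop).aestronglyMeasurable).congr ?_
      filter_upwards [ae_restrict_mem measurableSet_Ioi] with t ht
      rw [hgf _ (mul_pos hε ht)]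
    · filter_upwards [self_mem_nhdsWithin] with ε hε
      filter_upwards [ae_restrict_mem measurableSet_Ioi] with t ht
      rw [norm_smul, Real.norm_of_nonneg (by positivity)]
      gcongr
      exact hB _ (mul_pos hε ht)
    · filter_upwards [ae_restrict_mem measurableSet_Ioi] with t ht
      refine (havg.comp ?_).const_smul _
      refine tendsto_nhdsWithin_iff.2 ⟨?_, ?_⟩
      · have : Tendsto (fun ε : ℝ => ε * t) (𝓝 0) (𝓝 (0 * t)) := tendsto_id.mul_const t
        rw [zero_mul] at this
        exact this.mono_left nhdsWithin_le_nhds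
      · filter_upwards [self_mem_nhdsWithin] with ε hε
        exact Set.mem_Ioi.2 (mul_pos hε ht)
  rw [integral_smul_const, integral_layerWeight] at key
  refine key.congr' ?_
  filter_upwards [self_mem_nhdsWithin] with ε hε
  exact (integral_poissonKernel_eq hf z hε).symm

end Poisson

/-! ### The Hardy space projection and the Cauchy operator -/

section CauchyKernel

lemma ofReal_sub_ne_zero {u : ℂ} (hu : u.im ≠ 0) (s : ℝ) : (s : ℂ) - u ≠ 0 := by
  intro h
  apply hu
  simpa using congrArg Complex.im h

lemma memLp_inv_ofReal_sub {u : ℂ} (hu : u.im ≠ 0) : MemLp (fun s : ℝ => ((s : ℂ) - u)⁻¹) 2 := by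
  have hm : Measurable fun s : ℝ => ((s : ℂ) - u)⁻¹ := by fun_prop
  rw [memLp_two_iff_integrable_sq_norm hm.aestronglyMeasurable]
  refine (integrable_inv_sub_sq_add_sq u.re hu).congr (ae_of_all _ fun s => ?_)
  simp only
  rw [norm_inv, inv_pow, Complex.sq_norm, Complex.normSq_apply]
  simp
  ring

lemma div_mem_slitPlane {p q : ℂ} (hp : p.im < 0) (hq : q.im < 0) : p / q ∈ Complex.slitPlane := by
  have hq0 : q ≠ 0 := by
    rintro rfl
    simp at hq
  rw [Complex.mem_slitPlane_iff]
  by_contra! h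
  have h1 : p.im = (p / q * q).im := by rw [div_mul_cancel₀ _ hq0]
  rw [Complex.mul_im, h.2] at h1
  nlinarith [h.1]

lemma tendsto_inv_ofReal_sub (u : ℂ) :
    Tendsto (fun s : ℝ => ((s : ℂ) - u)⁻¹) (Bornology.cobounded ℝ) (𝓝 0) := by
  refine tendsto_inv₀_cobounded.comp ?_
  rw [← tendsto_norm_atTop_iff_cobounded]
  refine tendsto_atTop_mono (f := fun s : ℝ => ‖s‖ - ‖u‖) (fun s => ?_)
    (tendsto_atTop_add_const_right _ _ tendsto_norm_cobounded_atTop)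
  simpa using norm_sub_norm_le (s : ℂ) u

/-- With both poles on the same side of the axis, the integrand has a global antiderivative
vanishing at both ends. -/
lemma integral_inv_mul_inv {a b : ℂ} (ha : 0 < a.im) (hb : 0 < b.im) :
    ∫ s : ℝ, ((s : ℂ) - a)⁻¹ * ((s : ℂ) - b)⁻¹ = 0 := by
  have hint : Integrable fun s : ℝ => ((s : ℂ) - a)⁻¹ * ((s : ℂ) - b)⁻¹ :=
    (memLp_inv_ofReal_sub ha.ne').integrable_mul (memLp_inv_ofReal_sub hb.ne')
  have hd (u : ℂ) (s : ℝ) : HasDerivAt (fun s : ℝ => (s : ℂ) - u) 1 s := by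
    simpa using (Complex.ofRealCLM.hasDerivAt (x := s)).sub_const u
  suffices h : ∃ F : ℝ → ℂ, (∀ s : ℝ, HasDerivAt F (((s : ℂ) - a)⁻¹ * ((s : ℂ) - b)⁻¹) s) ∧
      Tendsto F (Bornology.cobounded ℝ) (𝓝 0) by
    obtain ⟨F, hF, h0⟩ := h
    have hcob : atBot ≤ Bornology.cobounded ℝ ∧ atTop ≤ Bornology.cobounded ℝ := by
      rw [← sup_le_iff, IsOrderBornology.cobounded_eq]
    rw [integral_of_hasDerivAt_of_tendsto hF hint (h0.mono_left hcob.1)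
      (h0.mono_left hcob.2), sub_zero]
  rcases eq_or_ne a b with rfl | hab
  · refine ⟨fun s => -((s : ℂ) - a)⁻¹, fun s => ?_, by simpa using (tendsto_inv_ofReal_sub a).neg⟩
    have h0 := ofReal_sub_ne_zero ha.ne' s
    refine ((hd a s).inv h0).neg.congr_deriv ?_
    field_simp
  -- Both `s - a` and `s - b` lie in the lower half-plane, so their quotient avoids the cut of the
  -- logarithm; it tends to `1` at infinity.
  · refine ⟨fun s => (a - b)⁻¹ * Complex.log (((s : ℂ) - a) / ((s : ℂ) - b)), fun s => ?_, ?_⟩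
    · have h0 := ofReal_sub_ne_zero ha.ne' s
      have h1 := ofReal_sub_ne_zero hb.ne' s
      refine ((((hd a s).div (hd b s) h1).clog_real (div_mem_slitPlane (by simpa) (by simpa))).const_mul
        (a - b)⁻¹).congr_deriv ?_
      have h2 := sub_ne_zero.2 hab
      simp only [Pi.div_apply]
      field_simp
      ring
    · have h1 : Tendsto (fun s : ℝ => ((s : ℂ) - a) / ((s : ℂ) - b)) (Bornology.cobounded ℝ) (𝓝 1) := by
        have := ((tendsto_inv_ofReal_sub b).const_mul (b - a)).const_add 1
        rw [mul_zero, add_zero] at this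
        refine this.congr fun s => ?_
        have h1 := ofReal_sub_ne_zero hb.ne' s
        field_simp
        ring
      have h2 := (h1.clog Complex.one_mem_slitPlane).const_mul (a - b)⁻¹
      simpa using h2

/-- The function `s ↦ 1 / (s - u)` as an element of `L²(ℝ)`; zero for real `u`. -/
noncomputable def cauchyKernel (u : ℂ) : Lp ℂ 2 (volume : Measure ℝ) :=
  if hu : u.im ≠ 0 then (memLp_inv_ofReal_sub hu).toLp _ else 0

lemma coeFn_cauchyKernel {u : ℂ} (hu : u.im ≠ 0) :
    cauchyKernel u =ᵐ[volume] fun s : ℝ => ((s : ℂ) - u)⁻¹ := by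
  rw [cauchyKernel, dif_pos hu]
  exact MemLp.coeFn_toLp _

lemma inner_cauchyKernel {w : ℂ} (hw : w.im ≠ 0) (f : Lp ℂ 2 (volume : Measure ℝ)) :
    ⟪cauchyKernel (conj w), f⟫_ℂ = ∫ s : ℝ, f s / ((s : ℂ) - w) := by
  rw [L2.inner_def]
  refine integral_congr_ae ?_
  filter_upwards [coeFn_cauchyKernel (u := conj w) (by simpa using hw)] with s hs
  rw [hs]
  simp [div_eq_mul_inv]

lemma inner_cauchyKernel_eq_zero {u v : ℂ} (hu : u.im < 0) (hv : 0 < v.im) :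
    ⟪cauchyKernel u, cauchyKernel v⟫_ℂ = 0 := by
  have h := inner_cauchyKernel (w := conj u) (by simpa using hu.ne) (cauchyKernel v)
  rw [Complex.conj_conj] at h
  rw [h, ← integral_inv_mul_inv hv (b := conj u) (by simpa using hu)]
  refine integral_congr_ae ?_
  filter_upwards [coeFn_cauchyKernel hv.ne'] with s hs
  rw [hs, div_eq_mul_inv]

/-- The Hardy space of the lower half-plane, as the functions with vanishing Cauchy integral
in the upper half-plane. -/
noncomputable def hardyMinus : Submodule ℂ (Lp ℂ 2 (volume : Measure ℝ)) :=
  (Submodule.span ℂ (cauchyKernel '' {u | u.im < 0}))ᗮ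

noncomputable instance : hardyMinus.HasOrthogonalProjection := by
  unfold hardyMinus
  infer_instance

lemma cauchyKernel_mem_hardyMinus {v : ℂ} (hv : 0 < v.im) : cauchyKernel v ∈ hardyMinus := by
  rw [hardyMinus, Submodule.mem_orthogonal]
  intro g hg
  induction hg using Submodule.span_induction with
  | mem g hg =>
    obtain ⟨u, hu, rfl⟩ := hg
    exact inner_cauchyKernel_eq_zero hu hv
  | zero => simp
  | add g h _ _ hg hh => rw [inner_add_left, hg, hh, add_zero]
  | smul c g _ hg => rw [inner_smul_left, hg, mul_zero]

lemma integral_div_eq_zero_of_mem_hardyMinus {f : Lp ℂ 2 (volume : Measure ℝ)}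
    (hf : f ∈ hardyMinus) {w : ℂ} (hw : 0 < w.im) : ∫ s : ℝ, f s / ((s : ℂ) - w) = 0 := by
  rw [← inner_cauchyKernel hw.ne']
  exact (Submodule.mem_orthogonal _ _).1 hf _
    (Submodule.subset_span ⟨conj w, by simpa using hw, rfl⟩)

/-- The Cauchy integral at `w` is the pairing with the kernel at `conj w`, which lies in the Hardy
space and is fixed by the self-adjoint projection. -/
lemma integral_div_starProjection_hardyMinus (f : Lp ℂ 2 (volume : Measure ℝ)) {w : ℂ}
    (hw : w.im < 0) :
    ∫ s : ℝ, (hardyMinus.starProjection f) s / ((s : ℂ) - w) = ∫ s : ℝ, f s / ((s : ℂ) - w) := by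
  rw [← inner_cauchyKernel hw.ne, ← inner_cauchyKernel hw.ne,
    ← Submodule.inner_starProjection_left_eq_right, Submodule.starProjection_eq_self_iff.2]
  exact cauchyKernel_mem_hardyMinus (by simpa using hw)

lemma integrable_div_ofReal_sub (f : Lp ℂ 2 (volume : Measure ℝ)) {w : ℂ} (hw : w.im ≠ 0) :
    Integrable fun s : ℝ => f s / ((s : ℂ) - w) := by
  simp only [div_eq_mul_inv]
  exact (Lp.memLp f).integrable_mul (memLp_inv_ofReal_sub hw)

lemma cauchyIntegral_eq_poisson (f : Lp ℂ 2 (volume : Measure ℝ)) (z : ℝ) {ε : ℝ} (hε : 0 < ε) :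
    cauchyIntegral f ((z : ℂ) - ε * Complex.I) = -((Real.pi⁻¹ : ℝ) •
      ∫ s, (ε / ((s - z) ^ 2 + ε ^ 2)) • (hardyMinus.starProjection f) s) := by
  set g := hardyMinus.starProjection f with hg
  have hwm : ((z : ℂ) - ε * Complex.I).im < 0 := by simpa
  have hwp : 0 < ((z : ℂ) + ε * Complex.I).im := by simpa
  have hzero := integral_div_eq_zero_of_mem_hardyMinus (hardyMinus.starProjection_apply_mem f) hwp
  -- Subtract the vanishing integral at `z + iε`: the difference of the two kernels is `-2i` times
  -- the Poisson kernel.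
  have hdiff : ∫ s : ℝ, g s / ((s : ℂ) - ((z : ℂ) - ε * Complex.I)) =
      (-2 * Complex.I) * ∫ s, (ε / ((s - z) ^ 2 + ε ^ 2)) • g s := by
    rw [← sub_zero (∫ s : ℝ, g s / ((s : ℂ) - ((z : ℂ) - ε * Complex.I))), ← hzero,
      ← integral_sub (integrable_div_ofReal_sub g hwm.ne) (integrable_div_ofReal_sub g hwp.ne'),
      ← integral_const_mul]
    refine integral_congr_ae (ae_of_all _ fun s => ?_)
    have h1 := ofReal_sub_ne_zero hwm.ne s
    have h2 := ofReal_sub_ne_zero hwp.ne' s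
    have h3 : ((s - z : ℂ) ^ 2 + ε ^ 2) =
        ((s : ℂ) - ((z : ℂ) - ε * Complex.I)) * ((s : ℂ) - ((z : ℂ) + ε * Complex.I)) := by
      linear_combination ((ε : ℂ) ^ 2) * Complex.I_sq
    simp only [Complex.real_smul]
    push_cast
    rw [h3]
    field_simp
    ring
  rw [cauchyIntegral, ← integral_div_starProjection_hardyMinus f hwm, ← hg, hdiff,
    Complex.real_smul]
  have := Complex.I_ne_zero
  have := Complex.ofReal_ne_zero.2 Real.pi_ne_zero
  push_cast
  field_simp

/-- The Cauchy operator `C⁻` on `L²(ℝ)`. -/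
noncomputable def cauchyMinus : Lp ℂ 2 (volume : Measure ℝ) →L[ℂ] Lp ℂ 2 (volume : Measure ℝ) :=
  -hardyMinus.starProjection

lemma norm_cauchyMinus_le : ‖cauchyMinus‖ ≤ 1 := by
  rw [cauchyMinus, norm_neg]
  exact Submodule.starProjection_norm_le _

lemma norm_one_add_cauchyMinus_le : ‖1 + cauchyMinus‖ ≤ 1 := by
  rw [cauchyMinus, ← sub_eq_add_neg, ← Submodule.starProjection_orthogonal']
  exact Submodule.starProjection_norm_le _

/-- The boundary values of the Cauchy integral from below exist almost everywhere. -/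
theorem ae_tendsto_cauchyIntegral (f : Lp ℂ 2 (volume : Measure ℝ)) :
    ∀ᵐ z : ℝ, Tendsto (fun ε : ℝ => cauchyIntegral f ((z : ℂ) - ε * Complex.I))
      (𝓝[>] 0) (𝓝 (cauchyMinus f z)) := by
  filter_upwards [ae_tendsto_integral_poissonKernel (Lp.memLp (hardyMinus.starProjection f)),
    Lp.coeFn_neg (hardyMinus.starProjection f)] with z hz hneg
  have h := (hz.const_smul (Real.pi⁻¹ : ℝ)).neg
  rw [inv_smul_smul₀ Real.pi_ne_zero] at h
  have heq : cauchyMinus f z = -(hardyMinus.starProjection f) z := hneg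
  rw [heq]
  refine h.congr' ?_
  filter_upwards [self_mem_nhdsWithin] with ε hε
  exact (cauchyIntegral_eq_poisson f z hε).symm

lemma cauchyIntegral_congr {f g : ℝ → ℂ} (h : f =ᵐ[volume] g) : cauchyIntegral f = cauchyIntegral g := by
  ext w
  unfold cauchyIntegral
  congr 1
  refine integral_congr_ae ?_
  filter_upwards [h] with s hs
  rw [hs]

end CauchyKernel

/-! ### Inversion of the singular integral equation -/

section SingularIntegralEquation

lemma memLp_bounded_mul {f g : ℝ → ℂ} {c : ℝ} (hf : MemLp f 2) (hg : AEStronglyMeasurable g)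
    (hgc : ∀ s, ‖g s‖ ≤ c) : MemLp (fun s => g s * f s) 2 :=
  hf.of_le_mul (c := c) (hg.mul hf.1) (ae_of_all _ fun s => by
    rw [norm_mul]
    exact mul_le_mul_of_nonneg_right (hgc s) (norm_nonneg _))

/-- Multiplication by a bounded measurable function on `L²(ℝ)`. -/
noncomputable def mulCLM (a : ℝ → ℂ) (c : ℝ) (ha : AEStronglyMeasurable a)
    (hac : ∀ s, ‖a s‖ ≤ c) :
    Lp ℂ 2 (volume : Measure ℝ) →L[ℂ] Lp ℂ 2 (volume : Measure ℝ) :=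
  have hmem (f : Lp ℂ 2 (volume : Measure ℝ)) : MemLp (fun s => a s * f s) 2 :=
    memLp_bounded_mul (Lp.memLp f) ha hac
  LinearMap.mkContinuous
    { toFun := fun f => (hmem f).toLp _
      map_add' := fun f g => by
        rw [← MemLp.toLp_add, MemLp.toLp_eq_toLp_iff]
        filter_upwards [Lp.coeFn_add f g] with s hs
        rw [hs, Pi.add_apply, Pi.add_apply, mul_add]
      map_smul' := fun t f => by
        rw [RingHom.id_apply, ← MemLp.toLp_const_smul, MemLp.toLp_eq_toLp_iff]
        filter_upwards [Lp.coeFn_smul t f] with s hs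
        rw [hs, Pi.smul_apply, Pi.smul_apply, smul_eq_mul, smul_eq_mul, mul_left_comm] } c fun f => by
    refine Lp.norm_le_mul_norm_of_ae_le_mul ?_
    filter_upwards [MemLp.coeFn_toLp (hmem f)] with s hs
    simp only [LinearMap.coe_mk, AddHom.coe_mk, hs, norm_mul]
    exact mul_le_mul_of_nonneg_right (hac s) (norm_nonneg _)

lemma coeFn_mulCLM {a : ℝ → ℂ} {c : ℝ} (ha : AEStronglyMeasurable a) (hac : ∀ s, ‖a s‖ ≤ c)
    (f : Lp ℂ 2 (volume : Measure ℝ)) : mulCLM a c ha hac f =ᵐ[volume] fun s => a s * f s :=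
  MemLp.coeFn_toLp (memLp_bounded_mul (Lp.memLp f) ha hac)

lemma norm_mulCLM_le {a : ℝ → ℂ} {c : ℝ} (ha : AEStronglyMeasurable a) (hac : ∀ s, ‖a s‖ ≤ c) :
    ‖mulCLM a c ha hac‖ ≤ c := by
  refine ContinuousLinearMap.opNorm_le_bound _ ((norm_nonneg _).trans (hac 0)) fun f =>
    Lp.norm_le_mul_norm_of_ae_le_mul ?_
  filter_upwards [coeFn_mulCLM ha hac f] with s hs
  rw [hs, norm_mul]
  exact mul_le_mul_of_nonneg_right (hac s) (norm_nonneg _)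

/-- Right multiplication of matrices of `L²` functions by a `2 × 2` matrix of operators. -/
noncomputable def rightMulCLM (m : ℕ)
    (T : Fin 2 → Fin 2 → Lp ℂ 2 (volume : Measure ℝ) →L[ℂ] Lp ℂ 2 (volume : Measure ℝ)) :
    L2Mat m →L[ℂ] L2Mat m :=
  (PiLp.continuousLinearEquiv 2 ℂ _).symm.toContinuousLinearMap ∘L
    ContinuousLinearMap.pi (fun p : Fin m × Fin 2 =>
      ∑ k, T k p.2 ∘L ContinuousLinearMap.proj (p.1, k)) ∘L
    (PiLp.continuousLinearEquiv 2 ℂ _).toContinuousLinearMap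

lemma rightMulCLM_apply {m : ℕ}
    (T : Fin 2 → Fin 2 → Lp ℂ 2 (volume : Measure ℝ) →L[ℂ] Lp ℂ 2 (volume : Measure ℝ))
    (N : L2Mat m) (i : Fin m) (l : Fin 2) :
    rightMulCLM m T N (i, l) = T 0 l (N (i, 0)) + T 1 l (N (i, 1)) := by
  simp [rightMulCLM, Fin.sum_univ_two]

section Inverse

variable (A B : Lp ℂ 2 (volume : Measure ℝ) →L[ℂ] Lp ℂ 2 (volume : Measure ℝ))

/-- The operator `N ↦ C⁻(N S)` where `S` has rows `(-AB, -B)` and `(A, 0)`. -/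
noncomputable def cauchyJump (m : ℕ) : L2Mat m →L[ℂ] L2Mat m :=
  rightMulCLM m ![![-(cauchyMinus ∘L A ∘L B), -(cauchyMinus ∘L B)], ![cauchyMinus ∘L A, 0]]

variable {A B}

/-- `R` inverts the Schur complement `1 + C⁻ A (1 + C⁻) B`. -/
lemma exists_schur_inverse {c : ℝ} (hc : c < 1) (hA : ‖A‖ ≤ c) (hB : ‖B‖ ≤ c) :
    ∃ R : Lp ℂ 2 (volume : Measure ℝ) →L[ℂ] Lp ℂ 2 (volume : Measure ℝ),
      (∀ v, R v + cauchyMinus (A (B (R v) + cauchyMinus (B (R v)))) = v) ∧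
      ∀ v, R (v + cauchyMinus (A (B v + cauchyMinus (B v)))) = v := by
  set t : Lp ℂ 2 (volume : Measure ℝ) →L[ℂ] Lp ℂ 2 (volume : Measure ℝ) :=
    -(cauchyMinus * (A * ((1 + cauchyMinus) * B))) with ht
  have hc0 : 0 ≤ c := (norm_nonneg _).trans hA
  have hlt : ‖t‖ < 1 := calc
    ‖t‖ ≤ ‖cauchyMinus‖ * (‖A‖ * (‖1 + cauchyMinus‖ * ‖B‖)) := by
      rw [ht, norm_neg]
      refine (norm_mul_le _ _).trans ?_
      gcongr
      refine (norm_mul_le _ _).trans ?_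
      gcongr
      exact norm_mul_le _ _
    _ ≤ 1 * (c * (1 * c)) := by
      gcongr
      exacts [norm_cauchyMinus_le, norm_one_add_cauchyMinus_le]
    _ < 1 := by nlinarith
  have h1 := (Units.oneSub t hlt).mul_inv
  have h2 := (Units.oneSub t hlt).inv_mul
  have h3 : 1 - t = 1 + cauchyMinus * (A * ((1 + cauchyMinus) * B)) := by rw [ht, sub_neg_eq_add]
  rw [Units.val_oneSub, h3] at h1 h2
  exact ⟨_, fun v => DFunLike.congr_fun h1 v, fun v => DFunLike.congr_fun h2 v⟩

lemma exists_inverse_one_sub_cauchyJump {c : ℝ} (hc : c < 1) (hA : ‖A‖ ≤ c) (hB : ‖B‖ ≤ c)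
    (m : ℕ) : ∃ T : L2Mat m →L[ℂ] L2Mat m,
      (ContinuousLinearMap.id ℂ (L2Mat m) - cauchyJump A B m) ∘L T = ContinuousLinearMap.id ℂ _ ∧
      T ∘L (ContinuousLinearMap.id ℂ (L2Mat m) - cauchyJump A B m) =
        ContinuousLinearMap.id ℂ _ := by
  obtain ⟨R, hR, hR'⟩ := exists_schur_inverse hc hA hB
  -- Back substitution: `n₁ = R (g₁ + C⁻ A g₂)` and `n₂ = g₂ - C⁻ B n₁`.
  refine ⟨rightMulCLM m ![![R, -(cauchyMinus ∘L B ∘L R)],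
    ![R ∘L cauchyMinus ∘L A,
      ContinuousLinearMap.id ℂ _ - cauchyMinus ∘L B ∘L R ∘L cauchyMinus ∘L A]], ?_, ?_⟩
  · refine ContinuousLinearMap.ext fun N => PiLp.ext fun ⟨i, l⟩ => ?_
    have h := hR (N (i, 0) + cauchyMinus (A (N (i, 1))))
    fin_cases l
    · simp only [map_add] at h
      simp [cauchyJump, rightMulCLM_apply]
      rw [← sub_eq_zero] at h ⊢
      refine Eq.trans ?_ h
      abel
    · simp [cauchyJump, rightMulCLM_apply]
      abel
  · refine ContinuousLinearMap.ext fun N => PiLp.ext fun ⟨i, l⟩ => ?_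
    have h := hR' (N (i, 0))
    simp only [map_add] at h
    fin_cases l
    · simp [cauchyJump, rightMulCLM_apply]
      rw [← sub_eq_zero] at h ⊢
      refine Eq.trans ?_ h
      abel
    · have h' := congrArg (fun v => cauchyMinus (B v)) h
      simp only [map_add] at h'
      simp [cauchyJump, rightMulCLM_apply]
      rw [← sub_eq_zero] at h' ⊢
      rw [← neg_eq_zero]
      refine Eq.trans ?_ h'
      abel

end Inverse

lemma isCauchyMinus_of_ae_eq {m : ℕ} {f : ℝ → Matrix (Fin m) (Fin 2) ℂ} {W V : L2Mat m}
    (hf : ∀ i l, (fun s => f s i l) =ᵐ[volume] W (i, l))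
    (hV : ∀ i l, V (i, l) = cauchyMinus (W (i, l))) : IsCauchyMinus f V.eval := by
  refine ae_all_iff.2 fun i => ae_all_iff.2 fun l => ?_
  rw [cauchyIntegral_congr (hf i l)]
  filter_upwards [ae_tendsto_cauchyIntegral (W (i, l))] with z hz
  simpa [L2Mat.eval, hV] using hz

lemma IsCauchyMinus.ae_eq {m : ℕ} {f g h : ℝ → Matrix (Fin m) (Fin 2) ℂ} (hg : IsCauchyMinus f g)
    (hh : IsCauchyMinus f h) : g =ᵐ[volume] h := by
  filter_upwards [hg, hh] with z hgz hhz
  ext i l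
  exact tendsto_nhds_unique (hgz i l) (hhz i l)

/-- Boundary limits are unique almost everywhere, so the existential functions may be replaced by
fixed `L²` representatives. -/
lemma solvesEquation_iff {m : ℕ} {S : ℝ → Matrix (Fin 2) (Fin 2) ℂ}
    {F : ℝ → Matrix (Fin m) (Fin 2) ℂ} {N V G : L2Mat m}
    (hV : IsCauchyMinus (fun z => N.eval z * S z) V.eval) (hG : IsCauchyMinus F G.eval) :
    SolvesEquation S F N ↔ N - V = G := by
  have key (i : Fin m) (l : Fin 2) :
      ∀ᵐ z, (N - V) (i, l) z = N.eval z i l - V.eval z i l := by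
    filter_upwards [Lp.coeFn_sub (N (i, l)) (V (i, l))] with z hz
    exact hz
  constructor
  · rintro ⟨A, B, hA, hB, h⟩
    refine PiLp.ext fun ⟨i, l⟩ => Lp.ext ?_
    filter_upwards [h, hA.ae_eq hV, hB.ae_eq hG, key i l] with z hz hAz hBz hk
    rw [hk, ← hAz, ← Matrix.sub_apply, hz, hBz]
    rfl
  · rintro rfl
    refine ⟨_, _, hV, hG, ?_⟩
    filter_upwards [ae_all_iff.2 fun i => ae_all_iff.2 fun l => key i l] with z hz
    ext i l
    rw [Matrix.sub_apply, ← hz]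
    rfl

lemma isCauchyMinus_cauchyJump {a b : ℝ → ℂ} {c : ℝ} (ha : AEStronglyMeasurable a)
    (hb : AEStronglyMeasurable b) (hac : ∀ s, ‖a s‖ ≤ c) (hbc : ∀ s, ‖b s‖ ≤ c) {m : ℕ}
    (N : L2Mat m) :
    IsCauchyMinus (fun z => N.eval z * !![-(a z * b z), -b z; a z, 0])
      (cauchyJump (mulCLM a c ha hac) (mulCLM b c hb hbc) m N).eval := by
  refine isCauchyMinus_of_ae_eq (W := rightMulCLM m ![![-(mulCLM a c ha hac ∘L mulCLM b c hb hbc),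
    -(mulCLM b c hb hbc)], ![mulCLM a c ha hac, 0]] N) (fun i l => ?_) (fun i l => ?_)
  · rw [rightMulCLM_apply]
    fin_cases l
    · simp only [Fin.zero_eta, Matrix.cons_val_zero, Matrix.cons_val_one,
        neg_apply, ContinuousLinearMap.comp_apply]
      filter_upwards [Lp.coeFn_add (-(mulCLM a c ha hac (mulCLM b c hb hbc (N (i, 0)))))
          (mulCLM a c ha hac (N (i, 1))),
        Lp.coeFn_neg (mulCLM a c ha hac (mulCLM b c hb hbc (N (i, 0)))),
        coeFn_mulCLM ha hac (mulCLM b c hb hbc (N (i, 0))),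
        coeFn_mulCLM hb hbc (N (i, 0)), coeFn_mulCLM ha hac (N (i, 1))] with z h1 h2 h3 h4 h5
      rw [h1, Pi.add_apply, h2, Pi.neg_apply, h3, h4, h5]
      simp [Matrix.mul_apply, Fin.sum_univ_two, L2Mat.eval]
      ring
    · simp only [Fin.mk_one, Matrix.cons_val_zero, Matrix.cons_val_one,
        neg_apply, zero_apply, add_zero]
      filter_upwards [Lp.coeFn_neg (mulCLM b c hb hbc (N (i, 0))),
        coeFn_mulCLM hb hbc (N (i, 0))] with z h2 h4
      rw [h2, Pi.neg_apply, h4]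
      simp [Matrix.mul_apply, Fin.sum_univ_two, L2Mat.eval]
      ring
  · rw [cauchyJump, rightMulCLM_apply, rightMulCLM_apply]
    fin_cases l <;> simp

lemma exists_isCauchyMinus {m : ℕ} {F : ℝ → Matrix (Fin m) (Fin 2) ℂ}
    (hF : ∀ i l, MemLp (fun z => F z i l) 2) : ∃ G : L2Mat m, IsCauchyMinus F G.eval :=
  ⟨WithLp.toLp 2 fun p => cauchyMinus ((hF p.1 p.2).toLp _),
    isCauchyMinus_of_ae_eq (W := WithLp.toLp 2 fun p => (hF p.1 p.2).toLp _)
      (fun i l => (MemLp.coeFn_toLp (hF i l)).symm) fun _ _ => rfl⟩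

end SingularIntegralEquation

end NDNLS

/-! ### Application to the scattering data -/

theorem mainTheorem5
    (r₁ r₂ : ℂ → ℂ) (c₀ : ℝ) (hc₀ : c₀ < 1)
    (hr₁ : ∀ k ∈ NDNLS.contour, ‖r₁ k‖ ≤ c₀) (hr₂ : ∀ k ∈ NDNLS.contour, ‖r₂ k‖ ≤ c₀)
    (κ : ℝ → ℂ) (hκ : ∀ z : ℝ, κ z ^ 2 = (z : ℂ))
    (h₁ : MemLp (fun z : ℝ => r₁ (κ z)) 2 volume) (h₂ : MemLp (fun z : ℝ => r₂ (κ z)) 2 volume)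
    (hm : MemLp (NDNLS.rMinus κ r₁) 2 volume) (hp : MemLp (NDNLS.rPlus κ r₂) 2 volume)
    (x : ℝ) :
    (∀ j : Fin 2, ∃! N : NDNLS.L2Mat 2,
      NDNLS.SolvesEquation (fun z => NDNLS.jumpS r₁ r₂ x (κ z))
        (fun z => NDNLS.inhomF r₁ r₂ j x (κ z)) N) ∧
    ∀ m : ℕ, ∃ CS : NDNLS.L2Mat m →L[ℂ] NDNLS.L2Mat m,
      (∀ N : NDNLS.L2Mat m,
        NDNLS.IsCauchyMinus (fun z => N.eval z * NDNLS.jumpS r₁ r₂ x (κ z)) (CS N).eval) ∧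
      ∃ T : NDNLS.L2Mat m →L[ℂ] NDNLS.L2Mat m,
        (ContinuousLinearMap.id ℂ (NDNLS.L2Mat m) - CS) ∘L T = ContinuousLinearMap.id ℂ _ ∧
        T ∘L (ContinuousLinearMap.id ℂ (NDNLS.L2Mat m) - CS) = ContinuousLinearMap.id ℂ _ := by
  have hcont (z : ℝ) : κ z ∈ NDNLS.contour := by
    have h := congrArg Complex.im (hκ z)
    rw [pow_two, Complex.mul_im, Complex.ofReal_im] at h
    have : (κ z).im * (κ z).re = 0 := by linarith
    exact mul_eq_zero.1 this
  -- Since `k² = z` is real, the exponentials are unimodular and can be absorbed into `a` and `b`.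
  set e : ℝ → ℝ → ℂ := fun t z => Complex.exp (2 * t * Complex.I * z * x) with he
  have he_norm (t z : ℝ) : ‖e t z‖ = 1 := by simp [he, Complex.norm_exp]
  have he_meas (t : ℝ) : AEStronglyMeasurable (e t) := by
    have : Continuous (e t) := by fun_prop
    exact this.aestronglyMeasurable
  have he_mul (z : ℝ) : e 1 z * e (-1) z = 1 := by
    rw [he, ← Complex.exp_add]
    simp
  set a : ℝ → ℂ := fun z => e 1 z * r₁ (κ z) with ha
  set b : ℝ → ℂ := fun z => e (-1) z * r₂ (κ z) with hb
  have ham : AEStronglyMeasurable a := (he_meas 1).mul h₁.1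
  have hbm : AEStronglyMeasurable b := (he_meas (-1)).mul h₂.1
  have hac (z : ℝ) : ‖a z‖ ≤ c₀ := by simpa [ha, he_norm] using hr₁ _ (hcont z)
  have hbc (z : ℝ) : ‖b z‖ ≤ c₀ := by simpa [hb, he_norm] using hr₂ _ (hcont z)
  have hS (z : ℝ) : NDNLS.jumpS r₁ r₂ x (κ z) = !![-(a z * b z), -b z; a z, 0] := by
    have hab : a z * b z = r₁ (κ z) * r₂ (κ z) := by
      linear_combination (r₁ (κ z) * r₂ (κ z)) * he_mul z
    rw [hab, NDNLS.jumpS, hκ]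
    simp [ha, hb, he, mul_comm]
  have hop (m : ℕ) (N : NDNLS.L2Mat m) : NDNLS.IsCauchyMinus
      (fun z => N.eval z * NDNLS.jumpS r₁ r₂ x (κ z))
      (NDNLS.cauchyJump (NDNLS.mulCLM a c₀ ham hac) (NDNLS.mulCLM b c₀ hbm hbc) m N).eval := by
    simp only [hS]
    exact NDNLS.isCauchyMinus_cauchyJump ham hbm hac hbc N
  have hinv := NDNLS.exists_inverse_one_sub_cauchyJump hc₀ (NDNLS.norm_mulCLM_le ham hac)
    (NDNLS.norm_mulCLM_le hbm hbc)
  refine ⟨fun j => ?_, fun m => ⟨_, hop m, hinv m⟩⟩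
  have hF : ∀ i l, MemLp (fun z => NDNLS.inhomF r₁ r₂ j x (κ z) i l) 2 := by
    simp only [NDNLS.inhomF, hS]
    have ha2 : MemLp a 2 volume := NDNLS.memLp_bounded_mul h₁ (he_meas 1) fun z => (he_norm 1 z).le
    have hb2 : MemLp b 2 volume :=
      NDNLS.memLp_bounded_mul h₂ (he_meas (-1)) fun z => (he_norm (-1) z).le
    have hab2 : MemLp (fun z => a z * b z) 2 volume := NDNLS.memLp_bounded_mul hb2 ham hac
    -- The unbounded factors `2ik` and `1/(2ik)` are exactly those in `r₋` and `r₊`; in the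
    -- remaining product `a b / (2ik)`, the factor `a` is bounded.
    have hka : MemLp (fun z => 2 * Complex.I * κ z * a z) 2 volume := by
      refine (memLp_congr_ae (ae_of_all _ fun z => ?_)).1
        (NDNLS.memLp_bounded_mul hm (he_meas 1) fun z => (he_norm 1 z).le)
      simp only [NDNLS.rMinus, ha]
      ring
    have hkb : MemLp (fun z => (κ z)⁻¹ * (Complex.I * 2⁻¹) * b z) 2 volume := by
      refine (memLp_congr_ae (ae_of_all _ fun z => ?_)).1
        (NDNLS.memLp_bounded_mul hp (he_meas (-1)) fun z => (he_norm (-1) z).le)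
      simp only [NDNLS.rPlus, hb, div_eq_mul_inv, mul_inv, Complex.inv_I]
      ring
    have hkab : MemLp (fun z => (κ z)⁻¹ * (Complex.I * 2⁻¹) * (a z * b z)) 2 volume := by
      refine (memLp_congr_ae (ae_of_all _ fun z => ?_)).1 (NDNLS.memLp_bounded_mul hkb ham hac)
      ring
    intro i l
    fin_cases j <;> fin_cases i <;> fin_cases l <;>
      simp [NDNLS.rho, Matrix.mul_apply, Fin.sum_univ_two]
    exacts [hab2.neg, hb2.neg, hka, hkab, hkb, ha2]
  obtain ⟨G, hG⟩ := NDNLS.exists_isCauchyMinus hF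
  obtain ⟨T, hT, hT'⟩ := hinv 2
  refine ⟨T G, (NDNLS.solvesEquation_iff (hop 2 _) hG).2 (DFunLike.congr_fun hT G), fun N hN => ?_⟩
  rw [← (NDNLS.solvesEquation_iff (hop 2 N) hG).1 hN]
  exact (DFunLike.congr_fun hT' N).symm
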